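/- Let $G$ be a biautomatic group, let $X\subseteq G$ be a finite subset, and suppose that its centralizer $H=\mathrm{C}_G(X)$ is abelian. Let $\mathrm{Comm}_G(H)=\{g\in G : |H:H\cap gHg^{-1}|<\infty \text{ and } |gHg^{-1}:H\cap gHg^{-1}|<\infty\}$ be the commensurator of $H$ in $G$. Then there is a normal subgroup $\mathrm{Comm}^0_G(H)\lhd \mathrm{Comm}_G(H)$ of finite index in $\mathrm{Comm}_G(H)$ such that for every finitely generated subgroup $F\leqslant \mathrm{Comm}^0_G(H)$ there is a finite-index subgroup $K$ of $H$ that is centralized by $F$, that is, $fk=kf$ for all $f\in F$ and $k\in K$. Here $G$ is called biautomatic if there are a finite set $\mathcal A$ with an involution $a\mapsto a^{-1}$, a map $\mu:\mathcal A\to G$ with $\mu(a^{-1})=\mu(a)^{-1}$ for all $a\in\mathcal A$ whose image generates $G$, and a language $\mathcal L\subseteq \mathcal A^*$ such that: (i) every element of $G$ is represented by a word of $\mathcal L$; (ii) $\mathcal L$ is regular, that is, accepted by a finite state automaton; (iii) there is a constant $\zeta\ge 0$ such that any two edge paths $p,q$ in the Cayley graph of $G$ with respect to $\mathcal A$ that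 are labelled by words of $\mathcal L$ and whose starting points are at distance at most $1$ and whose endpoints are at distance at most $1$ satisfy $\mathrm{d}_{\mathcal A}(\widehat p(t),\widehat q(t))\le\zeta$ for all integers $t\ge 0$. Here $\mathrm{d}_{\mathcal A}$ is the word metric, and $\widehat p(t)$ is the $t$-th vertex of $p$ if $t$ is at most the length of $p$, and the endpoint of $p$ otherwise. -/

import Mathlib

/-- The element of `G` represented by a word over the alphabet `A`, where each letter is sent to an
element of `G` by `μ`. This is the extension of `μ` to the free monoid on `A`. -/
def wordEval {A G : Type*} [Group G] (μ : A → G) (W : List A) : G :=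
  (W.map μ).prod

/-- The word metric on `G`: the length of a shortest word representing `g⁻¹ * h`, that is, the
distance between the vertices `g` and `h` in the Cayley graph. (It is only used when every element
of `G` is represented by some word.) -/
noncomputable def wordDist {A G : Type*} [Group G] (μ : A → G) (g h : G) : ℕ :=
  sInf {n : ℕ | ∃ W : List A, W.length = n ∧ wordEval μ W = g⁻¹ * h}

/-- The vertex reached at time `t` along the edge path of the Cayley graph that starts at `g` and is
labelled by `W`. After time `W.length` the path stays at its endpoint. -/
def pathVertex {A G : Type*} [Group G] (μ : A → G) (g : G) (W : List A) (t : ℕ) : G :=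
  g * wordEval μ (W.take t)

/-- The edge paths starting at `g`, `h` and labelled by `U`, `V` are at distance at most `ζ` from
each other at every integer time. -/
def FellowTravel {A G : Type*} [Group G] (μ : A → G) (ζ : ℕ) (g : G) (U : List A)
    (h : G) (V : List A) : Prop :=
  ∀ t : ℕ, wordDist μ (pathVertex μ g U t) (pathVertex μ h V t) ≤ ζ

/-- `(A, L)`, with the map `μ : A → G`, is a biautomatic structure on the group `G`. -/
structure IsBiautomaticStructure {A G : Type*} [Group G] (μ : A → G) (L : Language A) : Prop where
  /-- The alphabet is finite. -/
  finite_alphabet : Finite A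
  /-- The alphabet is closed under inversion. -/
  closed_inv : ∃ ι : A → A, Function.Involutive ι ∧ ∀ a, μ (ι a) = (μ a)⁻¹
  /-- The alphabet generates the group. -/
  generates : Function.Surjective (wordEval μ)
  /-- Every element of the group is represented by a word of the language. -/
  represents : ∀ g : G, ∃ W ∈ L, wordEval μ W = g
  /-- The language is accepted by a finite state automaton. -/
  regular : L.IsRegular
  /-- Paths labelled by words of the language that start and end at distance at most one from each
  other uniformly fellow travel. -/
  fellow_travel : ∃ ζ : ℕ, ∀ U ∈ L, ∀ V ∈ L, ∀ g h : G,
    wordDist μ g h ≤ 1 → wordDist μ (g * wordEval μ U) (h * wordEval μ V) ≤ 1 →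
      FellowTravel μ ζ g U h V

/-- A group is biautomatic if it admits a biautomatic structure. -/
def IsBiautomatic (G : Type*) [Group G] : Prop :=
  ∃ (A : Type) (μ : A → G) (L : Language A), IsBiautomaticStructure μ L

/-! ### Fellow travelling and pumping in biautomatic structures -/

section BiautomaticStructure

open scoped Pointwise IsMulCommutative

variable {A G : Type*} [Group G] {μ : A → G} {L : Language A}

/-! Word lengths in the language define a polytope of real characters of `H`, and the commensurator
must preserve it. Pumping words that represent elements of `H` yields finitely many loops `c` with
lengths `ℓ c`. Each `h` in `H` is a bounded factor times a product of powers of loops, with total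
loop length at most that of any word of the language for `h`; conversely, up to a fixed factor, `c ^
n` has words of length at most `n * ℓ c` plus a constant (`exists_decomposition`).

The characters `f` with `f c ≤ ℓ c` form a compact convex set with finitely many extreme points, and
every character has a positive multiple in it. Conjugation changes lengths by a bounded amount
(`exists_length_le_add`), which disappears on division by `n`, so the set is invariant
(`mapsTo_conjCharacter`). Hence the extreme points are permuted and a finite-index subgroup fixes
all real characters. Since `H` is finitely generated, each element of that subgroup centralizes a
finite-index subgroup of `H` (`relIndex_centralizer_ne_zero`). For finitely generated `F`, intersect
over the generators. -/

@[simp]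
theorem wordEval_nil (μ : A → G) : wordEval μ [] = 1 := rfl

theorem wordEval_append (μ : A → G) (U V : List A) :
    wordEval μ (U ++ V) = wordEval μ U * wordEval μ V := by
  simp [wordEval]

@[simp]
theorem wordEval_singleton (μ : A → G) (a : A) : wordEval μ [a] = μ a := by
  simp [wordEval]

theorem wordEval_flatten_replicate (μ : A → G) (W : List A) (n : ℕ) :
    wordEval μ (List.replicate n W).flatten = wordEval μ W ^ n := by
  induction n with
  | zero => simp
  | succ n ih => rw [List.replicate_succ, List.flatten_cons, wordEval_append, ih, pow_succ']

/-- The elements of `G` represented by words of length at most `n`. -/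
def wordBall (μ : A → G) (n : ℕ) : Set G := wordEval μ '' {W | W.length ≤ n}

theorem finite_wordBall [Finite A] (μ : A → G) (n : ℕ) : (wordBall μ n).Finite :=
  (List.finite_length_le A n).image _

theorem wordEval_mem_wordBall (μ : A → G) {W : List A} {n : ℕ} (h : W.length ≤ n) :
    wordEval μ W ∈ wordBall μ n := ⟨W, h, rfl⟩

theorem wordDist_le_of_wordEval_eq {g h : G} {W : List A} (hW : wordEval μ W = g⁻¹ * h) :
    wordDist μ g h ≤ W.length := Nat.sInf_le ⟨W, rfl, hW⟩

theorem mem_wordBall_of_wordDist_le (hμ : Function.Surjective (wordEval μ)) {g h : G} {n : ℕ}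
    (hd : wordDist μ g h ≤ n) : g⁻¹ * h ∈ wordBall μ n := by
  obtain ⟨W₀, hW₀⟩ := hμ (g⁻¹ * h)
  obtain ⟨W, hl, hW⟩ := Nat.sInf_mem
    (s := {n : ℕ | ∃ W : List A, W.length = n ∧ wordEval μ W = g⁻¹ * h}) ⟨_, W₀, rfl, hW₀⟩
  exact ⟨W, hl.trans_le hd, hW⟩

theorem List.take_length_append_append (x y z : List A) :
    (x ++ y ++ z).take x.length = x := by
  simp

theorem List.take_length_add_append_append (x y z : List A) :
    (x ++ y ++ z).take (x.length + y.length) = x ++ y := by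
  rw [← List.length_append, List.take_left]

namespace IsBiautomaticStructure

/-- Paths labelled by words of a biautomatic structure fellow travel, also when their endpoints
differ by fixed elements of the group. -/
theorem exists_finite_fellowTravel (hL : IsBiautomaticStructure μ L) (p q : G) :
    ∃ S : Set G, S.Finite ∧ ∀ U ∈ L, ∀ V ∈ L, wordEval μ V = p⁻¹ * wordEval μ U * q →
      ∀ t, (wordEval μ (U.take t))⁻¹ * p * wordEval μ (V.take t) ∈ S := by
  have := hL.finite_alphabet
  obtain ⟨ζ, hζ⟩ := hL.fellow_travel
  have step : ∀ U ∈ L, ∀ V ∈ L, ∀ g : G, wordDist μ 1 g ≤ 1 →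
      wordDist μ (1 * wordEval μ U) (g * wordEval μ V) ≤ 1 → ∀ t,
      (wordEval μ (U.take t))⁻¹ * g * wordEval μ (V.take t) ∈ wordBall μ ζ := by
    intro U hU V hV g h1 h2 t
    have := mem_wordBall_of_wordDist_le hL.generates (hζ U hU V hV 1 g h1 h2 t)
    simpa [pathVertex, mul_assoc] using this
  have dist_self : ∀ g : G, wordDist μ g g ≤ 1 := fun g =>
    (wordDist_le_of_wordEval_eq (W := []) (by simp)).trans (by simp)
  have dist_mul : ∀ (g : G) (a : A), wordDist μ g (g * μ a) ≤ 1 := fun g a =>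
    (wordDist_le_of_wordEval_eq (W := [a]) (by simp)).trans (by simp)
  obtain ⟨P, rfl⟩ := hL.generates p
  -- Change `p`, then `q`, one letter at a time, interpolating a word `W` of the language. Each
  -- letter enlarges `S` by a factor `wordBall μ ζ`.
  induction P using List.reverseRecOn with
  | nil =>
    obtain ⟨Q, rfl⟩ := hL.generates q
    induction Q using List.reverseRecOn with
    | nil =>
      refine ⟨wordBall μ ζ, finite_wordBall μ ζ, fun U hU V hV h t => ?_⟩
      refine step U hU V hV 1 (dist_self 1) ?_ t
      rw [h]
      simpa using dist_self _
    | append_singleton Q a ih =>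
      obtain ⟨S, hS, h⟩ := ih
      refine ⟨S * wordBall μ ζ, hS.mul (finite_wordBall μ ζ), fun U hU V hV e t => ?_⟩
      obtain ⟨W, hW, eW⟩ := hL.represents ((wordEval μ [])⁻¹ * wordEval μ U * wordEval μ Q)
      refine ⟨_, h U hU W hW eW t, _, step W hW V hV 1 (dist_self 1) ?_ t, ?_⟩
      · rw [e, eW, wordEval_append, wordEval_singleton, ← mul_assoc _ _ (μ a), one_mul, one_mul]
        exact dist_mul _ a
      · simp [mul_assoc]
  | append_singleton P a ih =>
    obtain ⟨S, hS, h⟩ := ih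
    refine ⟨S * wordBall μ ζ, hS.mul (finite_wordBall μ ζ), fun U hU V hV e t => ?_⟩
    obtain ⟨W, hW, eW⟩ := hL.represents ((wordEval μ P)⁻¹ * wordEval μ U * q)
    refine ⟨_, h U hU W hW eW t, _, step W hW V hV (μ a) ?_ ?_ t, ?_⟩
    · simpa using dist_mul 1 a
    · rw [e, eW, wordEval_append, wordEval_singleton]
      simpa [mul_assoc] using dist_self _
    · simp [mul_assoc, wordEval_append]

end IsBiautomaticStructure

/-- A pumping lemma for regular languages, in which the pumped subword also respects a given
labelling of the positions by a finite set. -/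
theorem Language.IsRegular.exists_pumping (hL : L.IsRegular) {T : Type*} {S : Set T}
    (hS : S.Finite) : ∃ N : ℕ, ∀ W ∈ L, ∀ s : ℕ, s + N ≤ W.length → ∀ φ : ℕ → T, (∀ t, φ t ∈ S) →
      ∃ x y z : List A, W = x ++ y ++ z ∧ s ≤ x.length ∧ 0 < y.length ∧
        x.length + y.length ≤ s + N ∧ φ x.length = φ (x.length + y.length) ∧
        ∀ n : ℕ, x ++ (List.replicate n y).flatten ++ z ∈ L := by
  obtain ⟨σ, _, M, rfl⟩ := hL
  refine ⟨(Finset.univ ×ˢ hS.toFinset : Finset (σ × T)).card, fun W hW s hs φ hφ => ?_⟩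
  set N := (Finset.univ ×ˢ hS.toFinset : Finset (σ × T)).card with hN
  -- Pigeonhole on pairs of automaton state and label.
  have key : ∃ i ∈ Finset.range (N + 1), ∃ j ∈ Finset.range (N + 1), i ≠ j ∧
      (M.eval (W.take (s + i)), φ (s + i)) = (M.eval (W.take (s + j)), φ (s + j)) := by
    refine Finset.exists_ne_map_eq_of_card_lt_of_maps_to (t := Finset.univ ×ˢ hS.toFinset)
      (by rw [Finset.card_range]; omega) (fun i _ => ?_)
    simpa using hφ _
  have key' : ∃ i j, s ≤ i ∧ i < j ∧ j ≤ s + N ∧ M.eval (W.take i) = M.eval (W.take j) ∧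
      φ i = φ j := by
    obtain ⟨i, hi, j, hj, hne, h⟩ := key
    simp only [Finset.mem_range, Prod.mk.injEq] at hi hj h
    rcases lt_or_gt_of_ne hne with h' | h'
    · exact ⟨s + i, s + j, by omega, by omega, by omega, h.1, h.2⟩
    · exact ⟨s + j, s + i, by omega, by omega, by omega, h.1.symm, h.2.symm⟩
  obtain ⟨i, j, hsi, hij, hj, hM, hφij⟩ := key'
  have hx : (W.take i).length = i := List.length_take_of_le (by omega)
  have hy : ((W.take j).drop i).length = j - i := by
    rw [List.length_drop, List.length_take_of_le (by omega)]
  have hxy : W.take i ++ (W.take j).drop i = W.take j := by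
    conv_rhs => rw [← List.take_append_drop i (W.take j)]
    rw [List.take_take, min_eq_left hij.le]
  refine ⟨W.take i, (W.take j).drop i, W.drop j, ?_, by omega, by omega, by omega, ?_, fun n => ?_⟩
  · rw [hxy, List.take_append_drop]
  · rw [hx, hy, hφij]; congr 1; omega
  · have hloop : M.evalFrom (M.eval (W.take i)) ((W.take j).drop i) = M.eval (W.take i) := by
      rw [DFA.eval, ← DFA.evalFrom_of_append, hxy]; exact hM.symm
    have hpow : M.evalFrom (M.eval (W.take i)) (List.replicate n ((W.take j).drop i)).flatten =
        M.eval (W.take i) := by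
      induction n with
      | zero => simp
      | succ n ih => rw [List.replicate_succ, List.flatten_cons, DFA.evalFrom_of_append, hloop, ih]
    rw [DFA.mem_accepts, DFA.eval, DFA.evalFrom_of_append, DFA.evalFrom_of_append]
    change M.evalFrom (M.evalFrom (M.eval _) _) _ ∈ _
    rw [hpow, hM]
    rw [DFA.mem_accepts, ← List.take_append_drop j W, DFA.eval, DFA.evalFrom_of_append] at hW
    exact hW

namespace IsBiautomaticStructure

/-- Multiplying by fixed elements on both sides changes the length of a shortest representative in
the language by a bounded amount. -/
theorem exists_length_le_add (hL : IsBiautomaticStructure μ L) (p q : G) :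
    ∃ C : ℕ, ∀ U ∈ L, ∃ V ∈ L, wordEval μ V = p⁻¹ * wordEval μ U * q ∧
      V.length ≤ U.length + C := by
  classical
  obtain ⟨S, hS, h⟩ := hL.exists_finite_fellowTravel p q
  obtain ⟨N, hN⟩ := hL.regular.exists_pumping hS
  refine ⟨N, fun U hU => ?_⟩
  have hex : ∃ n : ℕ, ∃ V ∈ L, wordEval μ V = p⁻¹ * wordEval μ U * q ∧ V.length = n := by
    obtain ⟨V, hV, e⟩ := hL.represents (p⁻¹ * wordEval μ U * q)
    exact ⟨_, V, hV, e, rfl⟩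
  obtain ⟨V, hV, e, hl⟩ := Nat.find_spec hex
  refine ⟨V, hV, e, ?_⟩
  by_contra! hlt
  -- Past time `U.length` the path of `U` stands still, so a repeated label forces `y` to evaluate
  -- to `1`; deleting `y` contradicts minimality of `V`.
  obtain ⟨x, y, z, rfl, hx, hy, -, hφ, hmem⟩ := hN V hV U.length hlt.le _ (h U hU V hV e)
  have hy1 : wordEval μ y = 1 := by
    rw [List.take_of_length_le hx, List.take_of_length_le (l := U) (by omega),
      List.take_length_append_append, List.take_length_add_append_append, wordEval_append] at hφ
    simpa [mul_assoc] using hφ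
  refine Nat.find_min hex (m := (x ++ z).length) (by simp only [← hl, List.length_append]; omega)
    ⟨x ++ z, by simpa using hmem 0, ?_, rfl⟩
  rw [← e, wordEval_append, wordEval_append, wordEval_append, hy1, mul_one]

/-- The elements of an abelian centralizer of a finite set are products of elements of a finite set
and of values of finitely many loops that can be pumped. -/
theorem exists_decomposition (hL : IsBiautomaticStructure μ L) {X : Set G} (hX : X.Finite)
    [IsMulCommutative (Subgroup.centralizer X)] :
    ∃ (B : Finset (Subgroup.centralizer X)) (C : Finset (Subgroup.centralizer X × ℕ)),
      (∀ c ∈ C, 0 < c.2 ∧ ∃ (k : Subgroup.centralizer X) (m : ℕ), ∀ n : ℕ, ∃ W ∈ L,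
        wordEval μ W = k * c.1 ^ n ∧ W.length ≤ m + n * c.2) ∧
      ∀ W ∈ L, ∀ h : Subgroup.centralizer X, wordEval μ W = h → ∃ b ∈ B, ∃ n : C → ℕ,
        h = b * ∏ c, c.1.1 ^ n c ∧ ∑ c, n c * c.1.2 ≤ W.length := by
  classical
  have := hL.finite_alphabet
  have hcomm : ∀ a b : G, a ∈ Subgroup.centralizer X → b ∈ Subgroup.centralizer X →
      a * b = b * a := fun a b ha hb => congrArg Subtype.val
    (mul_comm (⟨a, ha⟩ : Subgroup.centralizer X) ⟨b, hb⟩)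
  choose S hS hSX using fun x : X => hL.exists_finite_fellowTravel x.1 x.1
  have := hX.to_subtype
  obtain ⟨N, hN⟩ := hL.regular.exists_pumping (Set.Finite.pi' hS)
  have hB : {h : Subgroup.centralizer X | (h : G) ∈ wordBall μ N}.Finite :=
    (finite_wordBall μ N).preimage Subtype.val_injective.injOn
  have hC : {c : Subgroup.centralizer X × ℕ | (0 < c.2 ∧ ∃ (k : Subgroup.centralizer X) (m : ℕ),
      ∀ n : ℕ, ∃ W ∈ L, wordEval μ W = k * c.1 ^ n ∧ W.length ≤ m + n * c.2) ∧
      (c.1 : G) ∈ wordBall μ N * (wordBall μ N)⁻¹ ∧ c.2 ≤ N}.Finite := by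
    refine Set.Finite.subset (Set.Finite.prod (t := {n | n ≤ N})
      (((finite_wordBall μ N).mul (finite_wordBall μ N).inv).preimage
      Subtype.val_injective.injOn) (Set.finite_le_nat N)) ?_
    rintro c ⟨-, h1, h2⟩
    exact ⟨h1, h2⟩
  refine ⟨hB.toFinset, hC.toFinset, fun c hc => ((hC.mem_toFinset).1 hc).1, ?_⟩
  intro W
  induction hlen : W.length using Nat.strong_induction_on generalizing W with
  | _ l ih =>
  subst hlen
  intro hW h hWh
  by_cases hle : W.length ≤ N
  · refine ⟨h, ?_, fun _ => 0, by simp, by simp⟩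
    rw [Set.Finite.mem_toFinset, Set.mem_ofPred_eq, ← hWh]
    exact wordEval_mem_wordBall μ hle
  -- Since `h` commutes with `X`, the path of `W` fellow travels its own translates by `X`. The
  -- labels conjugate `X` by prefixes of `W`; a repetition puts the loop `x y x⁻¹` in the
  -- centralizer. Starting at `0` keeps `x` and `x y` in a fixed ball, so only finitely many loops
  -- occur.
  obtain ⟨x, y, z, rfl, -, hy, hxy, hφ, hmem⟩ := hN W hW 0 (by omega)
    (fun t x => (wordEval μ (W.take t))⁻¹ * x * wordEval μ (W.take t)) (fun t x =>
      hSX x W hW W hW (by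
        rw [hWh, mul_assoc, ← h.2 x.1 x.2, inv_mul_cancel_left]) t)
  have hk : wordEval μ (x ++ y) * (wordEval μ x)⁻¹ ∈ Subgroup.centralizer X := by
    intro a ha
    have := congrFun hφ ⟨a, ha⟩
    simp only [List.take_length_append_append, List.take_length_add_append_append] at this
    have h1 := congrArg (fun g => wordEval μ (x ++ y) * g * (wordEval μ x)⁻¹) this
    simpa [mul_assoc] using h1.symm
  set c : Subgroup.centralizer X × ℕ := (⟨_, hk⟩, y.length) with hc
  -- For `n = 0` this is the shortened word, representing `h * c.1⁻¹`, to which induction applies.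
  have hval : ∀ n, wordEval μ (x ++ (List.replicate n y).flatten ++ z) =
      ((h * c.1⁻¹ : Subgroup.centralizer X) : G) * c.1 ^ n := by
    intro n
    have hx : (c.1 : G) ^ n * wordEval μ x = wordEval μ x * wordEval μ y ^ n := by
      have : (c.1 : G) = wordEval μ x * wordEval μ y * (wordEval μ x)⁻¹ := by
        simp [hc, wordEval_append]
      rw [this, conj_pow, inv_mul_cancel_right]
    have hz : wordEval μ x * wordEval μ z = (c.1 : G)⁻¹ * h := by
      rw [← hWh]
      simp [hc, wordEval_append, mul_assoc]
    rw [wordEval_append, wordEval_append, wordEval_flatten_replicate, ← hx, mul_assoc, hz]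
    norm_cast
    rw [mul_comm, mul_comm h]
  have hcC : c ∈ hC.toFinset := by
    rw [Set.Finite.mem_toFinset]
    refine ⟨⟨hy, h * c.1⁻¹, x.length + z.length, fun n => ⟨_, hmem n, hval n, ?_⟩⟩,
      ⟨_, wordEval_mem_wordBall μ ?_, _, Set.inv_mem_inv.2 (wordEval_mem_wordBall μ ?_), rfl⟩, ?_⟩
    · simp [hc]; omega
    · simp; omega
    · omega
    · simp only [hc]; omega
  obtain ⟨b, hb, n, e, hn⟩ := ih (x ++ z).length (by simp; omega) (x ++ z) rfl
    (by simpa using hmem 0) (h * c.1⁻¹) (by simpa using hval 0)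
  refine ⟨b, hb, n + Pi.single ⟨c, hcC⟩ 1, ?_, ?_⟩
  · simp only [Pi.add_apply, pow_add, Finset.prod_mul_distrib]
    rw [← mul_assoc, ← e, Finset.prod_eq_single ⟨c, hcC⟩]
    · simp
    · intro d _ hd; simp [Pi.single_eq_of_ne hd]
    · simp
  · simp only [Pi.add_apply, add_mul, Finset.sum_add_distrib]
    rw [Finset.sum_eq_single (f := fun d => (Pi.single _ 1 : _ → ℕ) d * _) ⟨c, hcC⟩]
    · have : c.2 = y.length := rfl
      simp at hn ⊢; omega
    · intro d _ hd; simp [Pi.single_eq_of_ne hd]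
    · simp

end IsBiautomaticStructure

end BiautomaticStructure

/-! ### Group actions on compact convex sets with finitely many extreme points -/

section InvariantConvexSets

/-- A group acting by affine maps on a compact convex set with finitely many extreme points has a
finite-index subgroup acting trivially. -/
theorem exists_finiteIndex_forall_fixed {E Γ : Type*} [AddCommGroup E] [Module ℝ E]
    [TopologicalSpace E] [T2Space E] [IsTopologicalAddGroup E] [ContinuousSMul ℝ E]
    [LocallyConvexSpace ℝ E] [Group Γ] {D : Set E} (hcomp : IsCompact D) (hconv : Convex ℝ D)
    (hfin : (D.extremePoints ℝ).Finite) (ρ : Γ → E →L[ℝ] E) (hmaps : ∀ g, Set.MapsTo (ρ g) D D)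
    (hone : ∀ x ∈ D, ρ 1 x = x) (hmul : ∀ g g', ∀ x ∈ D, ρ (g * g') x = ρ g (ρ g' x)) :
    ∃ N : Subgroup Γ, N.FiniteIndex ∧ ∀ g ∈ N, ∀ x ∈ D, ρ g x = x := by
  let _ : MulAction Γ D :=
    { smul := fun g x => ⟨ρ g x, hmaps g x.2⟩
      one_smul := fun x => Subtype.ext (hone x x.2)
      mul_smul := fun g g' x => Subtype.ext (hmul g g' x x.2) }
  have hinv : ∀ g, ∀ x ∈ D, ρ g (ρ g⁻¹ x) = x := fun g x hx => by
    rw [← hmul _ _ x hx, mul_inv_cancel, hone x hx]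
  have hext : ∀ g, ∀ x ∈ D.extremePoints ℝ, ρ g x ∈ D.extremePoints ℝ := by
    intro g x hx
    refine mem_extremePoints_iff_left.2 ⟨hmaps g hx.1, fun y hy z hz hxyz => ?_⟩
    have hx' : x ∈ openSegment ℝ (ρ g⁻¹ y) (ρ g⁻¹ z) := by
      obtain ⟨a, b, ha, hb, hab, h⟩ := hxyz
      refine ⟨a, b, ha, hb, hab, ?_⟩
      rw [← map_smul, ← map_smul, ← map_add, h, ← hmul _ _ x hx.1, inv_mul_cancel, hone x hx.1]
    rw [← (mem_extremePoints_iff_left.1 hx).2 _ (hmaps _ hy) _ (hmaps _ hz) hx', hinv g y hy]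
  have := hfin.to_subtype
  refine ⟨⨅ e : D.extremePoints ℝ, MulAction.stabilizer Γ (⟨e, e.2.1⟩ : D),
    Subgroup.finiteIndex_iInf fun e => ⟨?_⟩, fun g hg => ?_⟩
  · rw [MulAction.index_stabilizer]
    have horb : (MulAction.orbit Γ (⟨e, e.2.1⟩ : D)).Finite := by
      refine (hfin.preimage (f := ((↑) : D → E)) Subtype.val_injective.injOn).subset ?_
      rintro _ ⟨g, rfl⟩
      exact hext g e e.2
    exact ((Set.ncard_pos horb).2 ⟨_, MulAction.mem_orbit_self _⟩).ne'
  · have hfix : ∀ e ∈ D.extremePoints ℝ, ρ g e = e := fun e he =>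
      congrArg Subtype.val (MulAction.mem_stabilizer_iff.1 (Subgroup.mem_iInf.1 hg ⟨e, he⟩))
    have hF : IsClosed {x | ρ g x = x} := isClosed_eq (ρ g).continuous continuous_id
    have hFc : Convex ℝ {x | ρ g x = x} := by
      intro x hx y hy a b _ _ _
      simp only [Set.mem_ofPred_eq] at hx hy ⊢
      rw [map_add, map_smul, map_smul, hx, hy]
    intro x hx
    rw [← closure_convexHull_extremePoints hcomp hconv] at hx
    exact closure_minimal (convexHull_min hfix hFc) hF hx

end InvariantConvexSets

/-! ### The polytope of bounded real characters -/

section RealCharacters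

variable {H : Type*} [CommGroup H]

/-- A homomorphism to the additive group of the reals, as a function. -/
def IsRealCharacter (f : H → ℝ) : Prop := ∀ a b, f (a * b) = f a + f b

namespace IsRealCharacter

variable {f : H → ℝ}

theorem map_one (hf : IsRealCharacter f) : f 1 = 0 := by
  simpa using hf 1 1

theorem map_pow (hf : IsRealCharacter f) (a : H) (n : ℕ) : f (a ^ n) = n * f a := by
  induction n with
  | zero => simp [hf.map_one]
  | succ n ih => rw [pow_succ, hf, ih]; push_cast; ring

theorem map_inv (hf : IsRealCharacter f) (a : H) : f a⁻¹ = -f a := by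
  have := hf a a⁻¹
  rw [mul_inv_cancel, hf.map_one] at this
  linarith

theorem map_prod (hf : IsRealCharacter f) {ι : Type*} (s : Finset ι) (u : ι → H) :
    f (∏ i ∈ s, u i) = ∑ i ∈ s, f (u i) := by
  classical
  induction s using Finset.induction_on with
  | empty => simp [hf.map_one]
  | insert i s hi ih => rw [Finset.prod_insert hi, Finset.sum_insert hi, hf, ih]

end IsRealCharacter

/-- An element of a finitely generated abelian group on which all homomorphisms to the reals vanish
has finite order. -/
theorem isOfFinOrder_of_forall_isRealCharacter [Group.FG H] {h : H}
    (hh : ∀ f : H → ℝ, IsRealCharacter f → f h = 0) : IsOfFinOrder h := by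
  have : Module.Finite ℤ (Additive H) := Module.Finite.iff_addGroup_fg.2 inferInstance
  -- Modulo torsion the group is free of finite rank, so integral functionals separate its points.
  have key : (Submodule.torsion ℤ (Additive H)).mkQ (Additive.ofMul h) = 0 := by
    rw [← Module.forall_dual_apply_eq_zero_iff ℤ]
    intro φ
    have := hh (fun x => (φ ((Submodule.torsion ℤ (Additive H)).mkQ (Additive.ofMul x)) : ℝ))
      (fun a b => by simp)
    exact_mod_cast this
  rw [Submodule.mkQ_apply, Submodule.Quotient.mk_eq_zero, Submodule.mem_torsion_iff] at key
  obtain ⟨n, hn⟩ := key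
  rw [isOfFinOrder_iff_zpow_eq_one]
  exact ⟨n, nonZeroDivisors.coe_ne_zero n, hn⟩

/-- The real characters whose values on the first components of `C` are bounded by the second
components. -/
def boundedCharacters (C : Finset (H × ℕ)) : Set (H → ℝ) :=
  {f | IsRealCharacter f ∧ ∀ c ∈ C, f c.1 ≤ c.2}

variable {C : Finset (H × ℕ)}

theorem convex_boundedCharacters : Convex ℝ (boundedCharacters C) := by
  rintro f ⟨hf, hfC⟩ g ⟨hg, hgC⟩ a b ha hb hab
  refine ⟨fun x y => ?_, fun c hc => ?_⟩
  · simp only [Pi.add_apply, Pi.smul_apply, smul_eq_mul, hf x y, hg x y]; ring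
  · calc a * f c.1 + b * g c.1 ≤ a * c.2 + b * c.2 := by
          gcongr
          exacts [hfC c hc, hgC c hc]
      _ = c.2 := by rw [← add_mul, hab, one_mul]

theorem isClosed_boundedCharacters : IsClosed (boundedCharacters C) := by
  have : boundedCharacters C = (⋂ (a : H) (b : H), {f : H → ℝ | f (a * b) = f a + f b}) ∩
      ⋂ c ∈ C, {f : H → ℝ | f c.1 ≤ c.2} := by
    ext f; simp [boundedCharacters, IsRealCharacter]
  rw [this]
  refine (isClosed_iInter fun a => isClosed_iInter fun b => ?_).inter
    (isClosed_biInter fun c _ => ?_)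
  · exact isClosed_eq (by fun_prop) (by fun_prop)
  · exact isClosed_le (by fun_prop) (by fun_prop)

/-- If finitely many translates of the monoid generated by the first components of `C` cover the
group, then the values at each element of the characters bounded by `C` are uniformly bounded. -/
theorem exists_forall_boundedCharacters_le {B : Finset H}
    (hdec : ∀ h : H, ∃ b ∈ B, ∃ n : C → ℕ, h = b * ∏ c, c.1.1 ^ n c) (h : H) :
    ∃ a : ℝ, ∀ f ∈ boundedCharacters C, f h ≤ a := by
  choose b hb n hn using fun i : ℕ => hdec (h ^ i)
  -- Dickson's lemma finds two powers of `h` with the same `B`-factor and comparable exponents.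
  -- Their quotient is a product of nonnegative powers of loops, on which `f` is bounded.
  have hwqo : WellQuasiOrdered fun x y : B × (C → ℕ) => x.1 = y.1 ∧ x.2 ≤ y.2 :=
    (Finite.wellQuasiOrdered (· = ·)).prod wellQuasiOrdered_le
  obtain ⟨i, j, hij, h1, h2⟩ := hwqo fun i => (⟨b i, hb i⟩, n i)
  have h1 : b i = b j := congrArg Subtype.val h1
  refine ⟨∑ c, (n j c - n i c : ℕ) * (c.1.2 : ℝ), fun f hf => ?_⟩
  have hpow : h ^ (j - i) = ∏ c : C, c.1.1 ^ (n j c - n i c) := by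
    have : h ^ i * h ^ (j - i) = h ^ i * ∏ c : C, c.1.1 ^ (n j c - n i c) := by
      rw [← pow_add, Nat.add_sub_cancel' hij.le]
      conv_rhs => rw [hn i]
      rw [hn j, h1, mul_assoc, ← Finset.prod_mul_distrib]
      congr 1
      refine Finset.prod_congr rfl fun c _ => ?_
      rw [← pow_add, Nat.add_sub_cancel' (h2 c)]
    exact mul_left_cancel this
  have hle : ((j - i : ℕ) : ℝ) * f h ≤ ∑ c, (n j c - n i c : ℕ) * (c.1.2 : ℝ) := by
    rw [← hf.1.map_pow, hpow, hf.1.map_prod]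
    refine Finset.sum_le_sum fun c _ => ?_
    rw [hf.1.map_pow]
    exact mul_le_mul_of_nonneg_left (hf.2 c.1 c.2) (Nat.cast_nonneg _)
  have hpos : (1 : ℝ) ≤ (j - i : ℕ) := by exact_mod_cast (by omega : 1 ≤ j - i)
  have hnn : 0 ≤ ∑ c, (n j c - n i c : ℕ) * (c.1.2 : ℝ) := by positivity
  rcases le_total (f h) 0 with h0 | h0
  · exact h0.trans hnn
  · nlinarith

theorem isCompact_boundedCharacters {B : Finset H}
    (hdec : ∀ h : H, ∃ b ∈ B, ∃ n : C → ℕ, h = b * ∏ c, c.1.1 ^ n c) :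
    IsCompact (boundedCharacters C) := by
  choose a ha using exists_forall_boundedCharacters_le hdec
  refine (isCompact_univ_pi fun h => isCompact_Icc (a := -a h⁻¹) (b := a h)).of_isClosed_subset
    isClosed_boundedCharacters fun f hf h _ => ⟨?_, ha h f hf⟩
  have := ha h⁻¹ f hf
  rw [hf.1.map_inv] at this
  linarith

theorem exists_pos_smul_mem_boundedCharacters (hC : ∀ c ∈ C, 0 < c.2) {f : H → ℝ}
    (hf : IsRealCharacter f) : ∃ ε : ℝ, 0 < ε ∧ ε • f ∈ boundedCharacters C := by
  have h : ∀ᶠ ε : ℝ in nhdsWithin 0 (Set.Ioi 0), ∀ c ∈ C, ε * f c.1 < c.2 := by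
    refine (Filter.eventually_all_finset C).2 fun c hc => ?_
    refine nhdsWithin_le_nhds (ContinuousAt.eventually_lt (by fun_prop) (by fun_prop) ?_)
    simpa using hC c hc
  obtain ⟨ε, hε, hpos⟩ := (h.and self_mem_nhdsWithin).exists
  refine ⟨ε, hpos, fun a b => ?_, fun c hc => (hε c hc).le⟩
  simp only [Pi.smul_apply, smul_eq_mul, hf a b, mul_add]

/-- An extreme point is determined by the subset of `C` where its constraint is tight: if `f` and
`g` share this subset, then `f` can be pushed slightly away from `g` within the set, so `f` lies
between `g` and another point. -/
theorem finite_extremePoints_boundedCharacters (C : Finset (H × ℕ)) :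
    ((boundedCharacters C).extremePoints ℝ).Finite := by
  classical
  refine Set.Finite.of_finite_image (f := fun f => {c ∈ C | f c.1 = c.2})
    ((C.powerset.finite_toSet).subset ?_) ?_
  · rintro _ ⟨f, -, rfl⟩
    exact Finset.mem_coe.2 (Finset.mem_powerset.2 (Finset.filter_subset _ _))
  intro f hf g hg hfg
  have h : ∀ᶠ ε : ℝ in nhdsWithin 0 (Set.Ioi 0), ∀ c ∈ C,
      f c.1 + ε * (f c.1 - g c.1) ≤ c.2 := by
    refine (Filter.eventually_all_finset C).2 fun c hc => ?_
    rcases (hf.1.2 c hc).eq_or_lt with heq | hlt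
    · have hc' : c ∈ ({c ∈ C | g c.1 = c.2} : Finset _) := by
        simp only at hfg
        rw [← hfg]
        simp [hc, heq]
      have := (Finset.mem_filter.1 hc').2
      simp [heq, this]
    · refine nhdsWithin_le_nhds ?_
      have : ∀ᶠ ε : ℝ in nhds 0, f c.1 + ε * (f c.1 - g c.1) < c.2 :=
        ContinuousAt.eventually_lt (by fun_prop) (by fun_prop) (by simpa using hlt)
      exact this.mono fun _ => le_of_lt
  obtain ⟨ε, hε, hpos⟩ := (h.and self_mem_nhdsWithin).exists
  have hpos : 0 < ε := hpos
  have hz : f + ε • (f - g) ∈ boundedCharacters C := by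
    refine ⟨fun a b => ?_, fun c hc => hε c hc⟩
    simp only [Pi.add_apply, Pi.smul_apply, Pi.sub_apply, smul_eq_mul, hf.1.1 a b, hg.1.1 a b]
    ring
  refine ((mem_extremePoints_iff_left.1 hf).2 g hg.1 _ hz
    ⟨ε / (1 + ε), 1 / (1 + ε), by positivity, by positivity, by field_simp; ring, ?_⟩).symm
  ext x
  simp only [Pi.add_apply, Pi.smul_apply, Pi.sub_apply, smul_eq_mul]
  field_simp
  ring

end RealCharacters

/-! ### Action of the commensurator on real characters -/

section Commensurator

open scoped IsMulCommutative Pointwise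

variable {G : Type*} [Group G] {H : Subgroup G}

open Subgroup.Commensurable (commensurator)

theorem exists_conj_pow_mem {g : G} (hg : g ∈ commensurator H) (h : H) :
    ∃ m : ℕ, 0 < m ∧ g⁻¹ * (h : G) ^ m * g ∈ H := by
  obtain ⟨m, hm, -, hmem⟩ := Subgroup.exists_pow_mem_of_relIndex_ne_zero hg.1 h.2
  rw [Subgroup.mem_inf, Subgroup.mem_pointwise_smul_iff_inv_smul_mem] at hmem
  refine ⟨m, hm, ?_⟩
  have := hmem.1
  rw [ConjAct.smul_def] at this
  simpa using this

/-- The action of the commensurator of an abelian subgroup `H` on functions on `H`, which on real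
characters is induced by conjugation. -/
noncomputable def conjCharacter (g : commensurator H) : (H → ℝ) →L[ℝ] (H → ℝ) :=
  -- The value is `f (g⁻¹ h ^ m g) / m` for a chosen `m`; on real characters it does not depend on
  -- the choice.
  ContinuousLinearMap.pi fun h => ((exists_conj_pow_mem g.2 h).choose : ℝ)⁻¹ •
    ContinuousLinearMap.proj ⟨_, (exists_conj_pow_mem g.2 h).choose_spec.2⟩

variable [IsMulCommutative H]

/-- Both sides are the value of `f` at `g⁻¹ h ^ (m * n) g`. -/
theorem IsRealCharacter.natCast_mul_eq {f : H → ℝ} (hf : IsRealCharacter f) {g : G} {h k q : H}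
    {m n : ℕ} (hq : (q : G) = g⁻¹ * (h : G) ^ m * g) (hk : (k : G) = g⁻¹ * (h : G) ^ n * g) :
    n * f q = m * f k := by
  rw [← hf.map_pow, ← hf.map_pow]
  congr 1
  have hconj : ∀ x : G, g⁻¹ * x * g = MulAut.conj g⁻¹ x := fun x => by simp
  ext
  rw [SubmonoidClass.coe_pow, SubmonoidClass.coe_pow, hq, hk, hconj, hconj, ← _root_.map_pow,
    ← _root_.map_pow, ← pow_mul, ← pow_mul, mul_comm]

theorem natCast_mul_conjCharacter {f : H → ℝ} (hf : IsRealCharacter f) (g : commensurator H)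
    {h k : H} {n : ℕ} (hk : (k : G) = (g : G)⁻¹ * (h : G) ^ n * g) :
    n * conjCharacter g f h = f k := by
  obtain ⟨hm, hmem⟩ := (exists_conj_pow_mem g.2 h).choose_spec
  have := hf.natCast_mul_eq (q := ⟨_, hmem⟩) rfl hk
  simp only [conjCharacter, ContinuousLinearMap.coe_pi', smul_apply,
    ContinuousLinearMap.proj_apply, smul_eq_mul]
  rw [mul_left_comm, this, inv_mul_cancel_left₀]
  exact_mod_cast hm.ne'

theorem isRealCharacter_conjCharacter {f : H → ℝ} (hf : IsRealCharacter f)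
    (g : commensurator H) : IsRealCharacter (conjCharacter g f) := by
  intro a b
  obtain ⟨m, hm, ha⟩ := exists_conj_pow_mem g.2 a
  obtain ⟨n, hn, hb⟩ := exists_conj_pow_mem g.2 b
  have hconj : ∀ x : G, (g : G)⁻¹ * x * g = MulAut.conj (g : G)⁻¹ x := fun x => by simp
  have e1 := natCast_mul_conjCharacter hf g (h := a) (k := ⟨_, ha⟩) rfl
  have e2 := natCast_mul_conjCharacter hf g (h := b) (k := ⟨_, hb⟩) rfl
  have e3 := natCast_mul_conjCharacter hf g (h := a * b) (n := m * n)
    (k := ⟨_, ha⟩ ^ n * ⟨_, hb⟩ ^ m) (by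
      have : ((a * b : H) : G) ^ (m * n) = ((a : G) ^ m) ^ n * ((b : G) ^ n) ^ m := by
        rw [← pow_mul, ← pow_mul, mul_comm n m]
        exact_mod_cast congrArg Subtype.val (mul_pow a b (m * n))
      rw [this]
      simp only [hconj, map_mul, map_pow, Subgroup.coe_mul, SubmonoidClass.coe_pow])
  rw [hf, hf.map_pow, hf.map_pow, ← e1, ← e2] at e3
  have hm' : (m : ℝ) ≠ 0 := by exact_mod_cast hm.ne'
  have hn' : (n : ℝ) ≠ 0 := by exact_mod_cast hn.ne'
  push_cast at e3
  apply mul_left_cancel₀ (mul_ne_zero hm' hn')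
  rw [e3]
  ring

theorem conjCharacter_one {f : H → ℝ} (hf : IsRealCharacter f) :
    conjCharacter (1 : commensurator H) f = f := by
  ext h
  simpa using natCast_mul_conjCharacter hf 1 (h := h) (k := h) (n := 1) (by simp)

theorem conjCharacter_mul {f : H → ℝ} (hf : IsRealCharacter f) (g g' : commensurator H) :
    conjCharacter (g * g') f = conjCharacter g (conjCharacter g' f) := by
  ext h
  obtain ⟨m, hm, hq⟩ := exists_conj_pow_mem g.2 h
  obtain ⟨n, hn, hr⟩ := exists_conj_pow_mem g'.2 ⟨_, hq⟩
  have e1 := natCast_mul_conjCharacter (isRealCharacter_conjCharacter hf g') g (h := h)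
    (k := ⟨_, hq⟩) rfl
  have e2 := natCast_mul_conjCharacter hf g' (h := ⟨_, hq⟩) (k := ⟨_, hr⟩) rfl
  have e3 := natCast_mul_conjCharacter hf (g * g') (h := h) (n := m * n) (k := ⟨_, hr⟩) (by
    have hconj : ∀ x : G, (g : G)⁻¹ * x * g = MulAut.conj (g : G)⁻¹ x := fun x => by simp
    simp only [hconj]
    rw [← map_pow, ← pow_mul, ← hconj]
    simp [mul_assoc])
  have hm' : (m : ℝ) ≠ 0 := by exact_mod_cast hm.ne'
  have hn' : (n : ℝ) ≠ 0 := by exact_mod_cast hn.ne'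
  push_cast at e3
  apply mul_left_cancel₀ (mul_ne_zero hm' hn')
  rw [e3, ← e2, ← e1]
  ring

/-- An element of the commensurator of a finitely generated abelian subgroup which acts trivially
on real characters centralizes a subgroup of finite index. -/
theorem relIndex_centralizer_ne_zero [Group.FG H] {g : commensurator H}
    (hg : ∀ f : H → ℝ, IsRealCharacter f → conjCharacter g f = f) :
    (Subgroup.centralizer {(g : G)}).relIndex H ≠ 0 := by
  -- All characters vanish on `(g⁻¹ h ^ n g) (h ^ n)⁻¹`, so it has some finite order `e`, and then
  -- `g` commutes with `h ^ (n * e)`.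
  have htors : IsMulTorsion (H ⧸ (Subgroup.centralizer {(g : G)}).subgroupOf H) := by
    intro x
    obtain ⟨h, rfl⟩ := QuotientGroup.mk_surjective x
    obtain ⟨n, hn, hk⟩ := exists_conj_pow_mem g.2 h
    obtain ⟨e, he, hpow⟩ := isOfFinOrder_iff_pow_eq_one.1
      (isOfFinOrder_of_forall_isRealCharacter (h := (⟨_, hk⟩ : H) * (h ^ n)⁻¹) (fun f hf => by
        rw [hf, hf.map_inv, hf.map_pow, ← natCast_mul_conjCharacter hf g (n := n) (h := h) rfl,
          hg f hf, add_neg_cancel]))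
    refine isOfFinOrder_iff_pow_eq_one.2 ⟨n * e, Nat.mul_pos hn he, ?_⟩
    rw [mul_pow, inv_pow, mul_inv_eq_one, ← pow_mul] at hpow
    have hpow := congrArg Subtype.val hpow
    rw [← QuotientGroup.mk_pow, QuotientGroup.eq_one_iff, Subgroup.mem_subgroupOf,
      Subgroup.mem_centralizer_singleton_iff]
    have hconj : ∀ x : G, (g : G)⁻¹ * x * g = MulAut.conj (g : G)⁻¹ x := fun x => by simp
    simp only [SubmonoidClass.coe_pow, hconj] at hpow
    rw [← map_pow, ← pow_mul, ← hconj, mul_assoc, inv_mul_eq_iff_eq_mul] at hpow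
    simpa using hpow
  have := CommGroup.finite_of_fg_isMulTorsion _ htors
  exact Subgroup.index_ne_zero_of_finite

end Commensurator

/-! ### Elements centralizing a finite-index subgroup -/

section VirtualCentralizer

open Subgroup.Commensurable (commensurator)
open scoped Pointwise

variable {G : Type*} [Group G] (H : Subgroup G)

/-- The elements of the commensurator of `H` which centralize a finite-index subgroup of `H`. -/
def virtualCentralizer : Subgroup (commensurator H) where
  carrier := {g | (Subgroup.centralizer {(g : G)}).relIndex H ≠ 0}
  one_mem' := by
    have : Subgroup.centralizer {((1 : commensurator H) : G)} = ⊤ := by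
      ext; simp [Subgroup.mem_centralizer_singleton_iff]
    rw [Set.mem_ofPred_eq, this, Subgroup.relIndex_top_left]
    exact one_ne_zero
  mul_mem' := by
    intro a b ha hb
    refine mt (fun h0 => Subgroup.relIndex_eq_zero_of_le_left ?_ h0)
      (Subgroup.relIndex_inf_ne_zero ha hb)
    rintro x ⟨h1, h2⟩
    exact Subgroup.mem_centralizer_singleton_iff.2 (Commute.mul_right
      (Subgroup.mem_centralizer_singleton_iff.1 h1) (Subgroup.mem_centralizer_singleton_iff.1 h2))
  inv_mem' := by
    intro a ha
    refine mt (fun h0 => Subgroup.relIndex_eq_zero_of_le_left (fun x hx => ?_) h0) ha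
    exact Subgroup.mem_centralizer_singleton_iff.2 (Commute.inv_right
      (Subgroup.mem_centralizer_singleton_iff.1 hx))

/-- Conjugation by `g` carries finite index in `H` to finite index in `gHg⁻¹`, and commensurability
brings it back to `H`. -/
instance : (virtualCentralizer H).Normal where
  conj_mem n hn g := by
    have hconj : Subgroup.centralizer {((g * n * g⁻¹ : commensurator H) : G)} =
        ConjAct.toConjAct (g : G) • Subgroup.centralizer {(n : G)} := by
      ext x
      rw [Subgroup.mem_pointwise_smul_iff_inv_smul_mem, Subgroup.mem_centralizer_singleton_iff,
        Subgroup.mem_centralizer_singleton_iff, ← ConjAct.toConjAct_inv, ConjAct.toConjAct_smul]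
      change Commute x (g * n * g⁻¹ : G) ↔ Commute ((g : G)⁻¹ * x * (g : G)⁻¹⁻¹) n
      refine Iff.trans ?_ (Commute.conj_iff (g : G))
      simp [mul_assoc]
    have h1 : (ConjAct.toConjAct (g : G) • Subgroup.centralizer {(n : G)}).relIndex
        (ConjAct.toConjAct (g : G) • H) ≠ 0 := by
      rwa [Subgroup.relIndex_pointwise_smul]
    change Subgroup.relIndex _ _ ≠ 0
    rw [hconj]
    exact Subgroup.relIndex_ne_zero_trans h1 g.2.1

variable {H}

theorem exists_le_centralizer_of_fg {F : Subgroup G} (hF : F.FG)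
    (hle : F ≤ (virtualCentralizer H).map (commensurator H).subtype) :
    ∃ K : Subgroup G, K ≤ H ∧ (K.subgroupOf H).FiniteIndex ∧
      F ≤ Subgroup.centralizer (K : Set G) := by
  obtain ⟨S, rfl⟩ := hF
  refine ⟨(⨅ s : S, Subgroup.centralizer {(s : G)}) ⊓ H, inf_le_right, ⟨?_⟩, ?_⟩
  · change Subgroup.relIndex _ _ ≠ 0
    rw [Subgroup.inf_relIndex_right]
    refine Subgroup.relIndex_iInf_ne_zero fun s => ?_
    obtain ⟨g, hg, hgs⟩ := hle (Subgroup.subset_closure s.2)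
    rw [← hgs]
    exact hg
  · rw [Subgroup.closure_le]
    intro s hs k hk
    exact Subgroup.mem_centralizer_singleton_iff.1 (Subgroup.mem_iInf.1 hk.1 ⟨s, hs⟩)

end VirtualCentralizer

/-! ### Invariance of the polytope and finite index -/

section Biautomatic

open scoped IsMulCommutative
open Subgroup.Commensurable (commensurator)

namespace IsBiautomaticStructure

variable {A G : Type*} [Group G] {μ : A → G} {L : Language A} {H : Subgroup G}
  [IsMulCommutative H]

/-- The commensurator preserves the set of real characters bounded by pumpable loops that dominate
all words of the language. -/
theorem mapsTo_conjCharacter (hL : IsBiautomaticStructure μ L) {B : Finset H} {C : Finset (H × ℕ)}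
    (hC : ∀ c ∈ C, ∃ (k : H) (m : ℕ), ∀ n : ℕ, ∃ W ∈ L,
      wordEval μ W = k * c.1 ^ n ∧ W.length ≤ m + n * c.2)
    (hdec : ∀ W ∈ L, ∀ h : H, wordEval μ W = h → ∃ b ∈ B, ∃ n : C → ℕ,
      h = b * ∏ c, c.1.1 ^ n c ∧ ∑ c, n c * c.1.2 ≤ W.length) (g : commensurator H) :
    Set.MapsTo (conjCharacter g) (boundedCharacters C) (boundedCharacters C) := by
  intro f hf
  refine ⟨isRealCharacter_conjCharacter hf.1 g, fun c hc => ?_⟩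
  obtain ⟨m, hm, hq⟩ := exists_conj_pow_mem g.2 c.1
  have hm' : (0 : ℝ) < m := by exact_mod_cast hm
  refine le_of_mul_le_mul_left ?_ hm'
  rw [natCast_mul_conjCharacter hf.1 g (n := m) (h := c.1) (k := ⟨_, hq⟩) rfl]
  set q : H := ⟨_, hq⟩
  obtain ⟨M, hM⟩ := (B.finite_toSet.image f).bddAbove
  obtain ⟨k, l, hk⟩ := hC c hc
  -- Using `k * g` on the left cancels `k`: the word for `k * c.1 ^ (m * n)` becomes one for `q ^
  -- n`, with an error `N` independent of `n`.
  obtain ⟨N, hN⟩ := hL.exists_length_le_add (k * g : G) g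
  have hbound : ∀ n : ℕ, n * (f q - m * c.2) ≤ M + (l + N) := by
    intro n
    obtain ⟨U, hU, eU, lU⟩ := hk (m * n)
    obtain ⟨V, hV, eV, lV⟩ := hN U hU
    obtain ⟨b, hb, r, e, hr⟩ := hdec V hV (q ^ n) (by
      have hconj : ∀ x : G, (g : G)⁻¹ * x * g = MulAut.conj (g : G)⁻¹ x := fun x => by simp
      rw [eV, eU, SubmonoidClass.coe_pow]
      simp only [q, hconj]
      rw [← map_pow, ← pow_mul, ← hconj]
      simp [mul_assoc])
    have h1 : n * f q ≤ M + V.length := by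
      rw [← hf.1.map_pow, e, hf.1, hf.1.map_prod]
      refine add_le_add (hM ⟨b, hb, rfl⟩) ?_
      calc ∑ c : C, f (c.1.1 ^ r c) ≤ ∑ c : C, (r c * c.1.2 : ℝ) := by
            refine Finset.sum_le_sum fun c _ => ?_
            rw [hf.1.map_pow]
            exact mul_le_mul_of_nonneg_left (hf.2 c.1 c.2) (Nat.cast_nonneg _)
        _ ≤ V.length := by exact_mod_cast hr
    have h2 : (V.length : ℝ) ≤ l + m * n * c.2 + N := by exact_mod_cast lV.trans (by omega)
    nlinarith
  -- A bound uniform in `n` rules out a positive slope.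
  by_contra! hlt
  obtain ⟨n, hn⟩ := exists_nat_gt ((M + (l + N)) / (f q - m * c.2))
  rw [div_lt_iff₀ (by linarith)] at hn
  linarith [hbound n]

end IsBiautomaticStructure

theorem IsBiautomatic.finiteIndex_virtualCentralizer {G : Type*} [Group G] (hG : IsBiautomatic G)
    {X : Set G} (hX : X.Finite) [IsMulCommutative (Subgroup.centralizer X)] :
    (virtualCentralizer (Subgroup.centralizer X)).FiniteIndex := by
  obtain ⟨A, μ, L, hL⟩ := hG
  obtain ⟨B, C, hC, hdec⟩ := hL.exists_decomposition hX
  have hdec' : ∀ h : Subgroup.centralizer X, ∃ b ∈ B, ∃ n : C → ℕ,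
      h = b * ∏ c, c.1.1 ^ n c := by
    intro h
    obtain ⟨W, hW, e⟩ := hL.represents h
    obtain ⟨b, hb, n, h1, -⟩ := hdec W hW h e
    exact ⟨b, hb, n, h1⟩
  have : Group.FG (Subgroup.centralizer X) := by
    classical
    refine ⟨⟨B ∪ C.image Prod.fst, (Subgroup.eq_top_iff' _).2 fun h => ?_⟩⟩
    obtain ⟨b, hb, n, rfl⟩ := hdec' h
    refine mul_mem (Subgroup.subset_closure (by simp [hb]))
      (prod_mem fun c _ => pow_mem (Subgroup.subset_closure ?_) _)
    simp only [Finset.coe_union, Finset.coe_image]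
    exact Or.inr ⟨c.1, c.2, rfl⟩
  obtain ⟨N, hN, hfix⟩ := exists_finiteIndex_forall_fixed (isCompact_boundedCharacters hdec')
    convex_boundedCharacters (finite_extremePoints_boundedCharacters C)
    (conjCharacter (H := Subgroup.centralizer X))
    (hL.mapsTo_conjCharacter (fun c hc => (hC c hc).2) hdec)
    (fun f hf => conjCharacter_one hf.1) (fun g g' f hf => conjCharacter_mul hf.1 g g')
  refine Subgroup.finiteIndex_of_le (H := N) fun g hg => relIndex_centralizer_ne_zero fun f hf => ?_
  -- Loop lengths are positive, so a small multiple of any character lies in the polytope; linearity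
  -- then fixes the character itself.
  obtain ⟨ε, hε, hmem⟩ := exists_pos_smul_mem_boundedCharacters (fun c hc => (hC c hc).1) hf
  have := hfix g hg _ hmem
  rw [map_smul] at this
  exact smul_right_injective _ hε.ne' this

end Biautomatic

theorem mainTheorem5 {G : Type*} [Group G] (hG : IsBiautomatic G) (X : Set G) (hX : X.Finite)
    (H : Subgroup G) (hH : H = Subgroup.centralizer X) (hab : IsMulCommutative H) :
    ∃ N : Subgroup (Subgroup.Commensurable.commensurator H), N.Normal ∧ N.FiniteIndex ∧
      ∀ F : Subgroup G, F.FG → F ≤ N.map (Subgroup.Commensurable.commensurator H).subtype →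
        ∃ K : Subgroup G, K ≤ H ∧ (K.subgroupOf H).FiniteIndex ∧
          F ≤ Subgroup.centralizer (K : Set G) := by
  subst hH
  exact ⟨virtualCentralizer _, inferInstance, hG.finiteIndex_virtualCentralizer hX,
    fun F hF hle => exists_le_centralizer_of_fg hF hle⟩
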